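/- Conventions. A nontrivial probability measure $\mu$ on the unit circle $\mathbb{T}$ is a Borel probability measure on $\mathbb{T}$ with infinite support. Its monic orthogonal polynomials $\phi_n$ ($\deg\phi_n=n$) satisfy $\int_{\mathbb{T}}\bar z^{\,j}\phi_n(z)\,d\mu(z)=0$ for $0\le j\le n-1$, its Verblunsky coefficients are $\alpha_{n}=-\overline{\phi_{n+1}(0)}$, $n\ge 0$, and $\phi_n^*(z)=z^n\overline{\phi_n(1/\bar z)}$. Put $\tau_n=\phi_n(1)/\phi_n^*(1)$ and $$R_n(z)=\frac{\prod_{j=1}^{n}[1-\tau_{j-1}\alpha_{j-1}]}{\prod_{j=1}^{n}[1-\mathrm{Re}(\tau_{j-1}\alpha_{j-1})]}\;\frac{z\phi_n(z)-\tau_n\phi_n^*(z)}{z-1},\qquad n\ge 0.$$ A real sequence $\{d_n\}_{n\ge1}$ is a positive chain sequence if $d_n=(1-g_{n-1})g_n$ for all $n\ge1$, for some sequence $\{g_n\}_{n\ge0}$ (a parameter sequence of $\{d_n\}$) with $0\le g_0<1$ and $0<g_n<1$ for $n\ge1$; its minimal parameter sequence $\{m_n\}_{n\ge0}$ is the parameter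 sequence with $m_0=0$. A pair of real sequences $\{\{c_n\}_{n\ge1},\{d_n\}_{n\ge1}\}$ is associated with $\mu$ if $\{d_n\}$ is a positive chain sequence, $d_1=\frac{|1-\alpha_0|^2}{2(1-\mathrm{Re}\,\alpha_0)}$, $R_0(z)=1$, $R_1(z)=(1+ic_1)z+(1-ic_1)$ and $$R_{n+1}(z)=[(1+ic_{n+1})z+(1-ic_{n+1})]R_n(z)-4d_{n+1}zR_{n-1}(z),\qquad n\ge1.$$ Theorem. Let $\mu$ be a nontrivial probability measure on $\mathbb{T}$ with Verblunsky coefficients $\{\alpha_n\}_{n\ge0}$ and associated pair $\{\{c_n\},\{d_n\}\}$, let $\{m_n\}_{n\ge0}$ be the minimal parameter sequence of $\{d_n\}$, and suppose that $c_{2n}=-c_{2n-1}$ for all $n\ge1$. Let $\beta_n=-\frac{1+ic_{2n}}{1-ic_{2n}}$, $n\ge1$. Let $\tilde\mu$ be the nontrivial probability measure on $\mathbb{T}$ with the Verblunsky coefficients $$\tilde\alpha_{2n+1}=\Big(\prod_{j=1}^{n+1}\beta_j^2\Big)\alpha_{2n+1},\qquad \tilde\alpha_{2n}=\Big(\prod_{j=1}^{n}\beta_j^2\Big)\beta_{n+1}\alpha_{2n},\qquad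 n\ge0.$$ Then $\tilde\mu$ has an associated pair $\{\{\tilde c_n\},\{\tilde d_n\}\}$, whose second member has a minimal parameter sequence, and for every pair $\{\{\tilde c_n\},\{\tilde d_n\}\}$ associated with $\tilde\mu$, with $\{\tilde m_n\}_{n\ge0}$ the minimal parameter sequence of $\{\tilde d_n\}$, $$\tilde c_{2n}=\tilde c_{2n-1}=c_{2n},\qquad \tilde m_{2n-1}=1-m_{2n-1},\qquad \tilde m_{2n}=m_{2n},\qquad n\ge1.$$ -/

import Mathlib

noncomputable section

namespace OPUC

open MeasureTheory

/-- A nontrivial probability measure on the unit circle: a Borel probability measure on the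
complex plane, carried by the unit circle, whose support is infinite. -/
structure IsNontrivialCircleMeasure (μ : Measure ℂ) : Prop where
  isProbabilityMeasure : IsProbabilityMeasure μ
  carried_by_circle : μ (Metric.sphere (0 : ℂ) 1)ᶜ = 0
  infinite_support : μ.support.Infinite

/-- `φ` is the sequence of monic orthogonal polynomials on the unit circle of `μ`. -/
def IsMonicOPUC (μ : Measure ℂ) (φ : ℕ → Polynomial ℂ) : Prop :=
  ∀ n : ℕ, (φ n).Monic ∧ (φ n).natDegree = n ∧
    ∀ j < n, ∫ z, (starRingEnd ℂ z) ^ j * (φ n).eval z ∂μ = 0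

/-- The coefficients `α n = - conj (φ (n + 1) (0))`, `n ≥ 0`. -/
def verblunsky (φ : ℕ → Polynomial ℂ) (n : ℕ) : ℂ :=
  -(starRingEnd ℂ) ((φ (n + 1)).eval 0)

/-- `α` is the sequence of Verblunsky coefficients of `μ`. -/
def HasVerblunskyCoeffs (μ : Measure ℂ) (α : ℕ → ℂ) : Prop :=
  ∃ φ : ℕ → Polynomial ℂ, IsMonicOPUC μ φ ∧ ∀ n : ℕ, α n = verblunsky φ n

/-- The reversed polynomial `φ_n^*(z) = z ^ n * conj (φ_n (1 / conj z))`. -/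
def reversed (φ : ℕ → Polynomial ℂ) (n : ℕ) : Polynomial ℂ :=
  Polynomial.reflect n ((φ n).map (starRingEnd ℂ))

/-- `τ_n = φ_n(1) / φ_n^*(1)`. -/
def tau (φ : ℕ → Polynomial ℂ) (n : ℕ) : ℂ :=
  (φ n).eval 1 / (reversed φ n).eval 1

/-- The polynomial
`R_n(z) = (∏_{j ≤ n} (1 - τ_{j-1} α_{j-1})) / (∏_{j ≤ n} (1 - Re (τ_{j-1} α_{j-1})))
  * (z φ_n(z) - τ_n φ_n^*(z)) / (z - 1)`;
the last division is exact, since the numerator vanishes at `z = 1`. -/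
def paraOrthogonal (φ : ℕ → Polynomial ℂ) (n : ℕ) : Polynomial ℂ :=
  Polynomial.C
      ((∏ j ∈ Finset.range n, (1 - tau φ j * verblunsky φ j)) /
        ∏ j ∈ Finset.range n, (1 - ((tau φ j * verblunsky φ j).re : ℂ))) *
    ((Polynomial.X * φ n - Polynomial.C (tau φ n) * reversed φ n) /ₘ
      (Polynomial.X - Polynomial.C 1))

/-- `g = (g_n)_{n ≥ 0}` is a parameter sequence of `d = (d_n)_{n ≥ 1}` (`d 0` is not used). -/
def IsParameterSeq (d g : ℕ → ℝ) : Prop :=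
  (0 ≤ g 0 ∧ g 0 < 1) ∧ (∀ n : ℕ, 1 ≤ n → 0 < g n ∧ g n < 1) ∧
    ∀ n : ℕ, 1 ≤ n → d n = (1 - g (n - 1)) * g n

/-- `d = (d_n)_{n ≥ 1}` is a positive chain sequence. -/
def IsPositiveChainSeq (d : ℕ → ℝ) : Prop :=
  ∃ g : ℕ → ℝ, IsParameterSeq d g

/-- `m` is the minimal parameter sequence of `d`: the parameter sequence starting at `0`. -/
def IsMinimalParameterSeq (d m : ℕ → ℝ) : Prop :=
  IsParameterSeq d m ∧ m 0 = 0

/-- The pair of real sequences `(c_n)_{n ≥ 1}`, `(d_n)_{n ≥ 1}` is associated with `μ` (the values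
`c 0` and `d 0` are not used): `d` is a positive chain sequence, and `c_1, c_2, …` and
`d_2, d_3, …` are the coefficients of the three term recurrence of the polynomials `R_n` of `μ`.
The recurrence does not involve `d_1`, which is
`|1 - τ_0 α_0| ^ 2 / (2 (1 - Re (τ_0 α_0)))`, where `τ_0 = 1`. -/
def IsAssociatedPair (μ : Measure ℂ) (c d : ℕ → ℝ) : Prop :=
  IsPositiveChainSeq d ∧
  ∃ φ : ℕ → Polynomial ℂ, IsMonicOPUC μ φ ∧
    d 1 = ‖1 - verblunsky φ 0‖ ^ 2 / (2 * (1 - (verblunsky φ 0).re)) ∧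
    paraOrthogonal φ 0 = 1 ∧
    paraOrthogonal φ 1 =
      Polynomial.C (1 + Complex.I * (c 1 : ℂ)) * Polynomial.X +
        Polynomial.C (1 - Complex.I * (c 1 : ℂ)) ∧
    ∀ n : ℕ, 1 ≤ n →
      paraOrthogonal φ (n + 1) =
        (Polynomial.C (1 + Complex.I * (c (n + 1) : ℂ)) * Polynomial.X +
            Polynomial.C (1 - Complex.I * (c (n + 1) : ℂ))) * paraOrthogonal φ n -
          Polynomial.C (4 * (d (n + 1) : ℂ)) * Polynomial.X * paraOrthogonal φ (n - 1)

end OPUC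

end

noncomputable section

namespace OPUC

open MeasureTheory Polynomial
open scoped ComplexConjugate

/-! ### Integration of polynomials against a nontrivial measure on the circle. -/

namespace IsNontrivialCircleMeasure

variable {μ : Measure ℂ}

/-! Everything is governed by the numbers `w_n = τ_n α_n`, which lie in the open unit disc. The
Szegő recurrence gives the recurrence of the `R_n` with `c_{n+1} = -Im w_n / (1 - Re w_n)` and
`m_{n+1} = |1 - w_n|² / (2 (1 - Re w_n))`. These data are forced by the `R_n` and by `d_1`, so any
associated pair and its minimal parameters are given by these formulas (`IsAssociatedPair.fst_eq`,
`IsAssociatedPair.minimalParameterSeq_eq`).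

The phases evolve by `(1 + i c_{n+1}) τ_{n+1} = (1 - i c_{n+1}) τ_n` (`IsMonicOPUC.tau_succ'`). The
hypothesis `c_{2n} = -c_{2n-1}` therefore gives `τ_{2n} = 1` and `τ_{2n+1} = -β_{n+1}`. For the new
measure, with `P_n = ∏_{j ≤ n} β_j²`, induction gives `τ'_{2n} P_n = 1` and `τ'_{2n+1} P_n β_{n+1} =
-1`. Hence `w'_{2n+1} = w_{2n+1}`, which preserves the coefficients of even index up to the sign
relation on `c`, while `w'_{2n} = β_{n+1} w_{2n} = -((1 - conj w_{2n}) / (1 - w_{2n})) w_{2n}`. This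
last map sends `c` to `-c` and `m` to `1 - m` (`recurrenceCoeff_reflection`,
`chainParam_reflection`). -/

lemma ae_norm_eq_one (hμ : IsNontrivialCircleMeasure μ) : ∀ᵐ z ∂μ, ‖z‖ = 1 := by
  have h := hμ.carried_by_circle
  rw [← mem_ae_iff] at h
  filter_upwards [h] with z hz
  simpa using hz

lemma integrable (hμ : IsNontrivialCircleMeasure μ) {f : ℂ → ℂ} (hf : Continuous f) :
    Integrable f μ := by
  have := hμ.isProbabilityMeasure
  have h : IntegrableOn f (Metric.sphere (0 : ℂ) 1) μ :=
    hf.continuousOn.integrableOn_compact (isCompact_sphere _ _)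
  have h2 : μ.restrict (Metric.sphere (0 : ℂ) 1) = μ := by
    apply Measure.restrict_eq_self_of_ae_mem
    filter_upwards [hμ.ae_norm_eq_one] with z hz
    simpa using hz
  rwa [IntegrableOn, h2] at h

/-- The zero set is closed and of full measure, so it contains the support, which is infinite. -/
lemma eq_zero_of_ae_eval_eq_zero (hμ : IsNontrivialCircleMeasure μ) {f : ℂ[X]}
    (hf : ∀ᵐ z ∂μ, f.eval z = 0) : f = 0 := by
  by_contra h0
  apply hμ.infinite_support
  have hfin : {z : ℂ | f.eval z = 0}.Finite := by
    refine (f.roots.toFinset.finite_toSet).subset fun z hz => ?_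
    simpa [h0] using hz
  exact hfin.subset (Measure.support_subset_of_isClosed hfin.isClosed hf)

lemma integrable_normSq (hμ : IsNontrivialCircleMeasure μ) (f : ℂ[X]) :
    Integrable (fun z => ‖f.eval z‖ ^ 2) μ := by
  have h := (hμ.integrable (f := fun z => ((‖f.eval z‖ ^ 2 : ℝ) : ℂ)) (by fun_prop)).re
  simpa only [RCLike.re_to_complex, Complex.ofReal_re] using h

lemma integral_normSq_pos (hμ : IsNontrivialCircleMeasure μ) {f : ℂ[X]} (hf : f ≠ 0) :
    0 < ∫ z, ‖f.eval z‖ ^ 2 ∂μ := by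
  have hi := hμ.integrable_normSq f
  refine lt_of_le_of_ne (integral_nonneg fun z => by positivity) fun h => hf ?_
  apply hμ.eq_zero_of_ae_eval_eq_zero
  have := (integral_eq_zero_iff_of_nonneg (fun z => by positivity) hi).1 h.symm
  filter_upwards [this] with z hz
  simpa using hz

lemma integral_conj_eval_mul_eq_zero (hμ : IsNontrivialCircleMeasure μ) {f g : ℂ[X]}
    (h : ∀ j, f.coeff j ≠ 0 → ∫ z, (conj z) ^ j * g.eval z ∂μ = 0) :
    ∫ z, conj (f.eval z) * g.eval z ∂μ = 0 := by
  have h1 : ∀ z, conj (f.eval z) * g.eval z =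
      ∑ j ∈ f.support, conj (f.coeff j) * ((conj z) ^ j * g.eval z) := fun z => by
    rw [eval_eq_sum, Polynomial.sum, map_sum, Finset.sum_mul]
    exact Finset.sum_congr rfl fun j _ => by simp [mul_assoc]
  simp_rw [h1]
  rw [integral_finsetSum _ fun j _ => hμ.integrable (by fun_prop)]
  refine Finset.sum_eq_zero fun j hj => ?_
  rw [integral_const_mul, h j (mem_support_iff.1 hj), mul_zero]

/-- Orthogonality to the monomials occurring in `f` itself already gives `∫ |f|² = 0`. Polynomial
identities below follow by checking which coefficients of a difference can survive. -/
lemma eq_zero_of_orthogonal (hμ : IsNontrivialCircleMeasure μ) {f : ℂ[X]}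
    (h : ∀ j, f.coeff j ≠ 0 → ∫ z, (conj z) ^ j * f.eval z ∂μ = 0) : f = 0 := by
  by_contra hf
  have h1 := hμ.integral_conj_eval_mul_eq_zero h
  have h2 : ∀ z, conj (f.eval z) * f.eval z = ((‖f.eval z‖ ^ 2 : ℝ) : ℂ) := fun z => by
    rw [Complex.conj_mul']; simp
  simp_rw [h2] at h1
  rw [integral_complex_ofReal, Complex.ofReal_eq_zero] at h1
  exact (hμ.integral_normSq_pos hf).ne' h1

end IsNontrivialCircleMeasure

/-! ### Reversed polynomials, the Szegő recurrence and the phases `τ_n`. -/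

lemma coeff_reversed {φ : ℕ → ℂ[X]} {n j : ℕ} (hj : j ≤ n) :
    (reversed φ n).coeff j = conj ((φ n).coeff (n - j)) := by
  simp [reversed, coeff_reflect, revAt_le hj]

lemma coeff_reversed_of_lt {φ : ℕ → ℂ[X]} {n j : ℕ} (hd : (φ n).natDegree ≤ n) (hj : n < j) :
    (reversed φ n).coeff j = 0 := by
  simp [reversed, coeff_reflect, revAt_eq_self_of_lt hj, coeff_eq_zero_of_natDegree_lt (hd.trans_lt hj)]

lemma eval_reversed {φ : ℕ → ℂ[X]} {n : ℕ} (hd : (φ n).natDegree ≤ n) {z : ℂ} (hz : ‖z‖ = 1) :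
    (reversed φ n).eval z = z ^ n * conj ((φ n).eval z) := by
  have hzz : z * conj z = 1 := by rw [Complex.mul_conj']; simp [hz]
  have h1 : (reversed φ n).natDegree < n + 1 := by
    rw [Nat.lt_succ_iff, natDegree_le_iff_coeff_eq_zero]
    exact fun j hj => coeff_reversed_of_lt hd hj
  rw [eval_eq_sum_range' h1, eval_eq_sum_range' (Nat.lt_succ_of_le hd), map_sum, Finset.mul_sum,
    ← Finset.sum_range_reflect]
  refine Finset.sum_congr rfl fun j hj => ?_
  have hj : j ≤ n := Nat.lt_succ_iff.1 (Finset.mem_range.1 hj)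
  obtain ⟨k, rfl⟩ := Nat.exists_eq_add_of_le hj
  have e : j + k + 1 - 1 - j = k := by omega
  rw [e, coeff_reversed (by omega), Nat.add_sub_cancel, map_mul, map_pow, pow_add]
  have : z ^ j * conj z ^ j = 1 := by rw [← mul_pow, hzz, one_pow]
  linear_combination (-conj ((φ (j + k)).coeff j) * z ^ k) * this

namespace IsMonicOPUC

variable {μ : Measure ℂ} {φ ψ : ℕ → ℂ[X]}

lemma eq (hμ : IsNontrivialCircleMeasure μ) (hφ : IsMonicOPUC μ φ) (hψ : IsMonicOPUC μ ψ) :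
    φ = ψ := by
  funext n
  rw [← sub_eq_zero]
  apply hμ.eq_zero_of_orthogonal
  intro j hj
  have hjn : j < n := by
    by_contra hjn
    apply hj
    rcases (not_lt.1 hjn).eq_or_lt with rfl | h
    · have h1 := (hφ n).1.coeff_natDegree
      have h2 := (hψ n).1.coeff_natDegree
      rw [(hφ n).2.1] at h1
      rw [(hψ n).2.1] at h2
      simp [h1, h2]
    · rw [coeff_sub, coeff_eq_zero_of_natDegree_lt (by rwa [(hφ n).2.1]),
        coeff_eq_zero_of_natDegree_lt (by rwa [(hψ n).2.1]), sub_zero]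
  simp_rw [eval_sub, mul_sub]
  rw [integral_sub (hμ.integrable (by fun_prop)) (hμ.integrable (by fun_prop)),
    (hφ n).2.2 j hjn, (hψ n).2.2 j hjn, sub_zero]

lemma coeff_self (hφ : IsMonicOPUC μ φ) (n : ℕ) : (φ n).coeff n = 1 := by
  have h1 := (hφ n).1.coeff_natDegree
  rwa [(hφ n).2.1] at h1

lemma coeff_of_lt (hφ : IsMonicOPUC μ φ) {n j : ℕ} (h : n < j) : (φ n).coeff j = 0 :=
  coeff_eq_zero_of_natDegree_lt (by rwa [(hφ n).2.1])

lemma apply_zero (hφ : IsMonicOPUC μ φ) : φ 0 = 1 :=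
  (hφ 0).1.natDegree_eq_zero.1 (hφ 0).2.1

lemma orthogonal_X_mul (hμ : IsNontrivialCircleMeasure μ) (hφ : IsMonicOPUC μ φ) {n j : ℕ}
    (h1 : 1 ≤ j) (h2 : j ≤ n) : ∫ z, (conj z) ^ j * (X * φ n).eval z ∂μ = 0 := by
  obtain ⟨i, rfl⟩ := Nat.exists_eq_add_of_le' h1
  rw [← (hφ n).2.2 i h2]
  apply integral_congr_ae
  filter_upwards [hμ.ae_norm_eq_one] with z hz
  have hzz : z * conj z = 1 := by rw [Complex.mul_conj']; simp [hz]
  simp only [eval_mul, eval_X, pow_succ]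
  linear_combination (conj z ^ i * (φ n).eval z) * hzz

lemma orthogonal_reversed (hμ : IsNontrivialCircleMeasure μ) (hφ : IsMonicOPUC μ φ) {n j : ℕ}
    (h1 : 1 ≤ j) (h2 : j ≤ n) : ∫ z, (conj z) ^ j * (reversed φ n).eval z ∂μ = 0 := by
  rw [← map_zero (starRingEnd ℂ), ← (hφ n).2.2 (n - j) (by omega), ← integral_conj]
  apply integral_congr_ae
  filter_upwards [hμ.ae_norm_eq_one] with z hz
  have hzz : z * conj z = 1 := by rw [Complex.mul_conj']; simp [hz]
  obtain ⟨k, rfl⟩ := Nat.exists_eq_add_of_le h2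
  have : z ^ j * conj z ^ j = 1 := by rw [← mul_pow, hzz, one_pow]
  rw [eval_reversed (hφ _).2.1.le hz, Nat.add_sub_cancel_left, map_mul, map_pow, Complex.conj_conj,
    pow_add]
  linear_combination (z ^ k * conj ((φ (j + k)).eval z)) * this

/-- The Szegő recurrence. -/
lemma succ_eq (hμ : IsNontrivialCircleMeasure μ) (hφ : IsMonicOPUC μ φ) (n : ℕ) :
    φ (n + 1) = X * φ n - C (conj (verblunsky φ n)) * reversed φ n := by
  symm
  rw [← sub_eq_zero]
  apply hμ.eq_zero_of_orthogonal
  intro j hj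
  -- The constant coefficient cancels by the definition of `verblunsky`, and the one of degree `n +
  -- 1` because both sides are monic. Only degrees `1, …, n` remain, where all three terms are
  -- orthogonal.
  have hj0 : 1 ≤ j := by
    by_contra h
    obtain rfl : j = 0 := by omega
    apply hj
    have := hφ.coeff_self n
    rw [coeff_sub, coeff_sub, coeff_C_mul, coeff_reversed (Nat.zero_le n), Nat.sub_zero, this]
    simp [verblunsky, coeff_zero_eq_eval_zero]
  have hjn : j ≤ n := by
    by_contra h
    obtain ⟨i, rfl⟩ := Nat.exists_eq_add_of_le' hj0
    apply hj
    rw [coeff_sub, coeff_sub, coeff_X_mul, coeff_C_mul,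
      coeff_reversed_of_lt (hφ n).2.1.le (by omega)]
    rcases (show n ≤ i by omega).eq_or_lt with rfl | h
    · simp [hφ.coeff_self]
    · simp [hφ.coeff_of_lt h, hφ.coeff_of_lt (Nat.succ_lt_succ h)]
  have h1 := hφ.orthogonal_X_mul hμ hj0 hjn
  have h2 := hφ.orthogonal_reversed hμ hj0 hjn
  have h3 := (hφ (n + 1)).2.2 j (by omega)
  have h4 : ∀ z, conj z ^ j *
      (X * φ n - C (conj (verblunsky φ n)) * reversed φ n - φ (n + 1)).eval z =
      conj z ^ j * (X * φ n).eval z -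
      conj (verblunsky φ n) * (conj z ^ j * (reversed φ n).eval z) -
      conj z ^ j * (φ (n + 1)).eval z := fun z => by
    simp only [eval_sub, eval_mul, eval_C]; ring
  simp_rw [h4]
  rw [integral_sub (hμ.integrable (by fun_prop)) (hμ.integrable (by fun_prop)),
    integral_sub (hμ.integrable (by fun_prop)) (hμ.integrable (by fun_prop)),
    integral_const_mul, h1, h2, h3]
  simp

/-- On the circle this is `z^(n+1)` times the conjugate of the Szegő recurrence, and the circle
carries `μ`. -/
lemma reversed_succ_eq (hμ : IsNontrivialCircleMeasure μ) (hφ : IsMonicOPUC μ φ) (n : ℕ) :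
    reversed φ (n + 1) = reversed φ n - C (verblunsky φ n) * (X * φ n) := by
  rw [← sub_eq_zero]
  apply hμ.eq_zero_of_ae_eval_eq_zero
  filter_upwards [hμ.ae_norm_eq_one] with z hz
  have hzz : z * conj z = 1 := by rw [Complex.mul_conj']; simp [hz]
  have hn : z ^ n * conj z ^ n = 1 := by rw [← mul_pow, hzz, one_pow]
  simp only [eval_sub, eval_mul, eval_C, eval_X]
  rw [eval_reversed (hφ _).2.1.le hz, eval_reversed (hφ _).2.1.le hz, hφ.succ_eq hμ]
  simp only [eval_sub, eval_mul, eval_C, eval_X, map_sub, map_mul, Complex.conj_conj]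
  rw [eval_reversed (hφ _).2.1.le hz]
  simp only [map_mul, map_pow, Complex.conj_conj]
  linear_combination (z ^ n * conj ((φ n).eval z)) * hzz -
    verblunsky φ n * z * (φ n).eval z * hn

/-- Pythagoras: in `z φ_n = φ_{n+1} + conj a φ_n^*` the summands are orthogonal, and `|z φ_n| =
|φ_n^*|` on the circle, so `∫ |φ_{n+1}|² = (1 - |a|²) ∫ |φ_n^*|²`, with a positive left side. -/
lemma norm_verblunsky_lt_one (hμ : IsNontrivialCircleMeasure μ) (hφ : IsMonicOPUC μ φ) (n : ℕ) :
    ‖verblunsky φ n‖ < 1 := by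
  set a := verblunsky φ n with ha
  have h1 : ∫ z, conj ((reversed φ n).eval z) * (φ (n + 1)).eval z ∂μ = 0 := by
    apply hμ.integral_conj_eval_mul_eq_zero
    intro j hj
    apply (hφ (n + 1)).2.2 j
    by_contra h
    exact hj (coeff_reversed_of_lt (hφ n).2.1.le (by omega))
  have hi : Integrable (fun z => a * (conj ((reversed φ n).eval z) * (φ (n + 1)).eval z)) μ :=
    hμ.integrable (by fun_prop)
  have h2 : ∫ z, ‖(φ (n + 1)).eval z‖ ^ 2 ∂μ = ∫ z, ((1 - ‖a‖ ^ 2) * ‖(reversed φ n).eval z‖ ^ 2 -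
      2 * RCLike.re (a * (conj ((reversed φ n).eval z) * (φ (n + 1)).eval z))) ∂μ := by
    apply integral_congr_ae
    filter_upwards [hμ.ae_norm_eq_one] with z hz
    have e1 : z * (φ n).eval z = (φ (n + 1)).eval z + conj a * (reversed φ n).eval z := by
      simp [hφ.succ_eq hμ, ha]
    have e2 : ‖(reversed φ n).eval z‖ = ‖z * (φ n).eval z‖ := by
      simp [eval_reversed (hφ n).2.1.le hz, hz]
    have e3 : ‖(reversed φ n).eval z‖ ^ 2 =
        ‖(φ (n + 1)).eval z + conj a * (reversed φ n).eval z‖ ^ 2 := by rw [e2, e1]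
    generalize (φ (n + 1)).eval z = p at *
    generalize (reversed φ n).eval z = q at *
    simp only [← Complex.normSq_eq_norm_sq, Complex.normSq_apply, RCLike.re_to_complex,
      Complex.add_re, Complex.add_im, Complex.mul_re, Complex.mul_im, Complex.conj_re,
      Complex.conj_im] at e3 ⊢
    linear_combination -e3
  have hq := hμ.integrable_normSq (reversed φ n)
  rw [integral_sub (hq.const_mul _) (hi.re.const_mul _), integral_const_mul, integral_const_mul,
    integral_re hi, integral_const_mul, h1] at h2
  have h3 := hμ.integral_normSq_pos (hφ (n + 1)).1.ne_zero
  have h4 : 0 ≤ ∫ z, ‖(reversed φ n).eval z‖ ^ 2 ∂μ := integral_nonneg fun z => by positivity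
  simp only [mul_zero, map_zero, sub_zero] at h2
  rw [h2] at h3
  have := pos_of_mul_pos_left h3 h4
  nlinarith [norm_nonneg a]

lemma eval_one_reversed (hφ : IsMonicOPUC μ φ) (n : ℕ) :
    (reversed φ n).eval 1 = conj ((φ n).eval 1) := by
  simp [eval_reversed (hφ n).2.1.le]

/-- A zero would give `|φ_n(1)| = |α_n| |φ_n(1)|`, against `|α_n| < 1`. This makes `τ_n` a genuine
quotient. -/
lemma eval_one_ne_zero (hμ : IsNontrivialCircleMeasure μ) (hφ : IsMonicOPUC μ φ) (n : ℕ) :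
    (φ n).eval 1 ≠ 0 := by
  induction n with
  | zero => simp [hφ.apply_zero]
  | succ n ih =>
    rw [hφ.succ_eq hμ, eval_sub, eval_mul, eval_X, one_mul, eval_mul, eval_C,
      hφ.eval_one_reversed, ← map_mul]
    intro h
    have h1 := congrArg (‖·‖) (sub_eq_zero.1 h)
    simp only [RCLike.norm_conj, norm_mul] at h1
    have h2 := hφ.norm_verblunsky_lt_one hμ n
    have h3 := norm_pos_iff.2 ih
    nlinarith

lemma tau_zero (hφ : IsMonicOPUC μ φ) : tau φ 0 = 1 := by
  simp [tau, hφ.eval_one_reversed, hφ.apply_zero]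

lemma norm_tau (hμ : IsNontrivialCircleMeasure μ) (hφ : IsMonicOPUC μ φ) (n : ℕ) :
    ‖tau φ n‖ = 1 := by
  have := norm_ne_zero_iff.2 (hφ.eval_one_ne_zero hμ n)
  simp [tau, hφ.eval_one_reversed, this]

lemma tau_mul_conj (hμ : IsNontrivialCircleMeasure μ) (hφ : IsMonicOPUC μ φ) (n : ℕ) :
    tau φ n * conj (tau φ n) = 1 := by
  rw [Complex.mul_conj', hφ.norm_tau hμ]; simp

lemma norm_tau_mul_verblunsky_lt_one (hμ : IsNontrivialCircleMeasure μ) (hφ : IsMonicOPUC μ φ)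
    (n : ℕ) : ‖tau φ n * verblunsky φ n‖ < 1 := by
  rw [norm_mul, hφ.norm_tau hμ, one_mul]
  exact hφ.norm_verblunsky_lt_one hμ n

lemma tau_succ (hμ : IsNontrivialCircleMeasure μ) (hφ : IsMonicOPUC μ φ) (n : ℕ) :
    tau φ (n + 1) = tau φ n *
      ((1 - conj (tau φ n * verblunsky φ n)) / (1 - tau φ n * verblunsky φ n)) := by
  have h0 : conj ((φ n).eval 1) ≠ 0 := (_root_.map_ne_zero _).2 (hφ.eval_one_ne_zero hμ n)
  have h1 := (_root_.map_ne_zero (starRingEnd ℂ)).2 (hφ.eval_one_ne_zero hμ (n + 1))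
  have h2 : (φ n).eval 1 = tau φ n * conj ((φ n).eval 1) := by
    rw [tau, hφ.eval_one_reversed, div_mul_cancel₀ _ h0]
  have h3 := hφ.tau_mul_conj hμ n
  have e1 : (φ (n + 1)).eval 1 =
      (tau φ n - conj (verblunsky φ n)) * conj ((φ n).eval 1) := by
    rw [hφ.succ_eq hμ, eval_sub, eval_mul, eval_X, one_mul, eval_mul, eval_C,
      hφ.eval_one_reversed]
    linear_combination h2
  have e2 : conj ((φ (n + 1)).eval 1) =
      (1 - tau φ n * verblunsky φ n) * conj ((φ n).eval 1) := by
    rw [← hφ.eval_one_reversed, hφ.reversed_succ_eq hμ, eval_sub, eval_mul, eval_C, eval_mul,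
      eval_X, hφ.eval_one_reversed]
    linear_combination -verblunsky φ n * h2
  have h5 : 1 - tau φ n * verblunsky φ n ≠ 0 := by
    intro h; rw [h, zero_mul] at e2; exact h1 e2
  rw [tau, hφ.eval_one_reversed, e2, e1, mul_div_mul_right _ _ h0, mul_div_assoc']
  congr 1
  rw [map_mul]
  linear_combination conj (verblunsky φ n) * h3

end IsMonicOPUC
-- Recurrence coefficients and chain parameters as functions of `w`.
/-- The coefficient `c_{n+1}` of the three term recurrence, as a function of `w = τ_n α_n`. -/
def recurrenceCoeff (w : ℂ) : ℝ := -w.im / (1 - w.re)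

/-- The parameter `m_{n+1}` of the chain sequence, as a function of `w = τ_n α_n`. -/
def chainParam (w : ℂ) : ℝ := ‖1 - w‖ ^ 2 / (2 * (1 - w.re))

section Coefficients

variable {w : ℂ}

lemma one_sub_re_pos (hw : ‖w‖ < 1) : 0 < 1 - w.re := by
  linarith [Complex.re_le_norm w]

lemma one_sub_ne_zero (hw : ‖w‖ < 1) : 1 - w ≠ 0 := by
  intro h
  rw [← sub_eq_zero.1 h] at hw
  simp at hw

lemma one_sub_ofReal_re_ne_zero (hw : ‖w‖ < 1) : (1 - w.re : ℂ) ≠ 0 := by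
  exact_mod_cast (one_sub_re_pos hw).ne'

lemma one_add_I_mul_recurrenceCoeff (hw : ‖w‖ < 1) :
    1 + Complex.I * (recurrenceCoeff w : ℂ) = (1 - w) / (1 - w.re) := by
  have h := one_sub_ofReal_re_ne_zero hw
  rw [recurrenceCoeff]
  push_cast
  field_simp
  linear_combination -Complex.re_add_im w

lemma one_sub_I_mul_recurrenceCoeff (hw : ‖w‖ < 1) :
    1 - Complex.I * (recurrenceCoeff w : ℂ) = (1 - conj w) / (1 - w.re) := by
  have h := congrArg conj (one_add_I_mul_recurrenceCoeff hw)
  simp only [map_add, map_mul, map_one, map_div₀, map_sub, Complex.conj_I,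
    Complex.conj_ofReal] at h
  rw [← h]; ring

lemma ofReal_chainParam : (chainParam w : ℂ) = (1 - w) * (1 - conj w) / (2 * (1 - w.re)) := by
  have h : (1 - w) * (1 - conj w) = ((‖1 - w‖ ^ 2 : ℝ) : ℂ) := by
    have := Complex.mul_conj' (1 - w)
    rw [map_sub, map_one] at this
    rw [this]; push_cast; rfl
  rw [h, chainParam]; push_cast; rfl

lemma ofReal_one_sub_chainParam (hw : ‖w‖ < 1) :
    (1 - chainParam w : ℂ) = (1 - w * conj w) / (2 * (1 - w.re)) := by
  have h := one_sub_ofReal_re_ne_zero hw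
  have h2 := Complex.add_conj w
  rw [ofReal_chainParam]
  field_simp
  push_cast at h2
  linear_combination h2

lemma one_sub_chainParam (hw : ‖w‖ < 1) :
    1 - chainParam w = (1 - ‖w‖ ^ 2) / (2 * (1 - w.re)) := by
  have h := ofReal_one_sub_chainParam hw
  rw [Complex.mul_conj'] at h
  exact_mod_cast h

lemma chainParam_pos (hw : ‖w‖ < 1) : 0 < chainParam w :=
  div_pos (pow_pos (norm_pos_iff.2 (one_sub_ne_zero hw)) 2)
    (mul_pos two_pos (one_sub_re_pos hw))

lemma chainParam_lt_one (hw : ‖w‖ < 1) : chainParam w < 1 := by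
  rw [← sub_pos, one_sub_chainParam hw]
  exact div_pos (by nlinarith [norm_nonneg w]) (mul_pos two_pos (one_sub_re_pos hw))

end Coefficients

/-- The minimal parameters `m_n` attached to the orthogonal polynomials `φ`. -/
def chainParamSeq (φ : ℕ → ℂ[X]) : ℕ → ℝ
  | 0 => 0
  | n + 1 => chainParam (tau φ n * verblunsky φ n)

/-- The normalizing constant of `paraOrthogonal φ n`. -/
def paraConst (φ : ℕ → ℂ[X]) (n : ℕ) : ℂ :=
  (∏ j ∈ Finset.range n, (1 - tau φ j * verblunsky φ j)) /
    ∏ j ∈ Finset.range n, (1 - ((tau φ j * verblunsky φ j).re : ℂ))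

/-! ### The three term recurrence of the `R_n`. -/

namespace IsMonicOPUC

variable {μ : Measure ℂ} {φ : ℕ → ℂ[X]}

lemma tau_succ' (hμ : IsNontrivialCircleMeasure μ) (hφ : IsMonicOPUC μ φ) (n : ℕ) :
    (1 + Complex.I * (recurrenceCoeff (tau φ n * verblunsky φ n) : ℂ)) * tau φ (n + 1) =
      (1 - Complex.I * (recurrenceCoeff (tau φ n * verblunsky φ n) : ℂ)) * tau φ n := by
  have hw := hφ.norm_tau_mul_verblunsky_lt_one hμ n
  rw [one_add_I_mul_recurrenceCoeff hw, one_sub_I_mul_recurrenceCoeff hw, hφ.tau_succ hμ]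
  have := one_sub_ne_zero hw
  field_simp

lemma paraConst_succ (hμ : IsNontrivialCircleMeasure μ) (hφ : IsMonicOPUC μ φ) (n : ℕ) :
    paraConst φ (n + 1) = paraConst φ n *
      (1 + Complex.I * (recurrenceCoeff (tau φ n * verblunsky φ n) : ℂ)) := by
  rw [one_add_I_mul_recurrenceCoeff (hφ.norm_tau_mul_verblunsky_lt_one hμ n), paraConst,
    Finset.prod_range_succ, Finset.prod_range_succ, mul_div_mul_comm, paraConst]

lemma paraConst_ne_zero (hμ : IsNontrivialCircleMeasure μ) (hφ : IsMonicOPUC μ φ) (n : ℕ) :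
    paraConst φ n ≠ 0 :=
  div_ne_zero
    (Finset.prod_ne_zero_iff.2 fun j _ =>
      one_sub_ne_zero (hφ.norm_tau_mul_verblunsky_lt_one hμ j))
    (Finset.prod_ne_zero_iff.2 fun j _ =>
      one_sub_ofReal_re_ne_zero (hφ.norm_tau_mul_verblunsky_lt_one hμ j))

lemma sub_mul_paraOrthogonal (hμ : IsNontrivialCircleMeasure μ) (hφ : IsMonicOPUC μ φ) (n : ℕ) :
    (X - C 1) * paraOrthogonal φ n =
      X * (C (paraConst φ n) * φ n) - C (paraConst φ n * tau φ n) * reversed φ n := by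
  have h : IsRoot (X * φ n - C (tau φ n) * reversed φ n) 1 := by
    have h0 : conj ((φ n).eval 1) ≠ 0 := (_root_.map_ne_zero _).2 (hφ.eval_one_ne_zero hμ n)
    simp [tau, hφ.eval_one_reversed, div_mul_cancel₀ _ h0]
  rw [paraOrthogonal, mul_left_comm, mul_divByMonic_eq_iff_isRoot.2 h, ← paraConst, C_mul]
  ring

/-- In terms of `p_n = K_n φ_n` and `q_n = K_n τ_n φ_n^*`, with `K_n` the normalizing constant, the
Szegő step depends on `α_n` only through `w_n`. -/
lemma mul_succ (hμ : IsNontrivialCircleMeasure μ) (hφ : IsMonicOPUC μ φ) (n : ℕ) :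
    C (paraConst φ (n + 1)) * φ (n + 1) =
      C (1 + Complex.I * (recurrenceCoeff (tau φ n * verblunsky φ n) : ℂ)) *
        (X * (C (paraConst φ n) * φ n) - C (conj (tau φ n * verblunsky φ n)) *
          (C (paraConst φ n * tau φ n) * reversed φ n)) := by
  have h : (C (tau φ n) * C (conj (tau φ n)) : ℂ[X]) = 1 := by
    rw [← C_mul, hφ.tau_mul_conj hμ, C_1]
  rw [hφ.paraConst_succ hμ, hφ.succ_eq hμ]
  simp only [map_mul]
  generalize C (1 + Complex.I * (recurrenceCoeff (tau φ n * verblunsky φ n) : ℂ)) = e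
  linear_combination
    (C (paraConst φ n) * e * C (conj (verblunsky φ n)) * reversed φ n) * h

lemma mul_reversed_succ (hμ : IsNontrivialCircleMeasure μ) (hφ : IsMonicOPUC μ φ) (n : ℕ) :
    C (paraConst φ (n + 1) * tau φ (n + 1)) * reversed φ (n + 1) =
      C (1 - Complex.I * (recurrenceCoeff (tau φ n * verblunsky φ n) : ℂ)) *
        (C (paraConst φ n * tau φ n) * reversed φ n - C (tau φ n * verblunsky φ n) *
          (X * (C (paraConst φ n) * φ n))) := by
  rw [hφ.paraConst_succ hμ, mul_assoc, hφ.tau_succ' hμ, hφ.reversed_succ_eq hμ]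
  simp only [C_mul]
  ring

lemma two_mul_chainParam {w : ℂ} (hw : ‖w‖ < 1) : (2 * chainParam w : ℂ) =
    (1 + Complex.I * (recurrenceCoeff w : ℂ)) * (1 - conj w) := by
  rw [one_add_I_mul_recurrenceCoeff hw, ofReal_chainParam]
  have h := one_sub_ofReal_re_ne_zero hw
  field_simp

lemma two_mul_chainParam' {w : ℂ} (hw : ‖w‖ < 1) : (2 * chainParam w : ℂ) =
    (1 - Complex.I * (recurrenceCoeff w : ℂ)) * (1 - w) := by
  rw [one_sub_I_mul_recurrenceCoeff hw, ofReal_chainParam]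
  have h := one_sub_ofReal_re_ne_zero hw
  field_simp

/-- Half of the recurrence: the remainder is a multiple of `p_n - q_n`, which
`mul_sub_mul_reversed_succ` identifies with a multiple of `(X - 1) R_{n-1}` when `n ≥ 1`. The two
factors multiply to `4 (1 - m_n) m_{n+1}`. -/
lemma sub_mul_paraOrthogonal_succ (hμ : IsNontrivialCircleMeasure μ) (hφ : IsMonicOPUC μ φ)
    (n : ℕ) :
    (X - C 1) * paraOrthogonal φ (n + 1) =
      (C (1 + Complex.I * (recurrenceCoeff (tau φ n * verblunsky φ n) : ℂ)) * X +
        C (1 - Complex.I * (recurrenceCoeff (tau φ n * verblunsky φ n) : ℂ))) *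
          ((X - C 1) * paraOrthogonal φ n) -
      C (2 * (chainParam (tau φ n * verblunsky φ n) : ℂ)) * X *
        (C (paraConst φ n) * φ n - C (paraConst φ n * tau φ n) * reversed φ n) := by
  have hw := hφ.norm_tau_mul_verblunsky_lt_one hμ n
  have h1 := congrArg (C (R := ℂ)) (two_mul_chainParam hw)
  have h2 := congrArg (C (R := ℂ)) (two_mul_chainParam' hw)
  rw [hφ.sub_mul_paraOrthogonal hμ, hφ.sub_mul_paraOrthogonal hμ, hφ.mul_succ hμ,
    hφ.mul_reversed_succ hμ]
  generalize tau φ n * verblunsky φ n = w at *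
  generalize C (paraConst φ n) * φ n = p
  generalize C (paraConst φ n * tau φ n) * reversed φ n = q
  rw [C_mul (a := _ + _), C_sub (b := conj w), C_1] at h1
  rw [C_mul (a := _ - _), C_sub (b := w), C_1] at h2
  linear_combination -(X * q) * h1 + (X * p) * h2

lemma mul_sub_mul_reversed_succ (hμ : IsNontrivialCircleMeasure μ) (hφ : IsMonicOPUC μ φ)
    (n : ℕ) :
    C (paraConst φ (n + 1)) * φ (n + 1) -
        C (paraConst φ (n + 1) * tau φ (n + 1)) * reversed φ (n + 1) =
      C (2 * (1 - chainParam (tau φ n * verblunsky φ n) : ℂ)) *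
        ((X - C 1) * paraOrthogonal φ n) := by
  have hw := hφ.norm_tau_mul_verblunsky_lt_one hμ n
  have h1 : (1 + Complex.I * (recurrenceCoeff (tau φ n * verblunsky φ n) : ℂ)) +
      (tau φ n * verblunsky φ n) *
        (1 - Complex.I * (recurrenceCoeff (tau φ n * verblunsky φ n) : ℂ)) =
      2 * (1 - chainParam (tau φ n * verblunsky φ n) : ℂ) := by
    have h := two_mul_chainParam' hw
    linear_combination h
  have h2 : (1 - Complex.I * (recurrenceCoeff (tau φ n * verblunsky φ n) : ℂ)) +
      conj (tau φ n * verblunsky φ n) *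
        (1 + Complex.I * (recurrenceCoeff (tau φ n * verblunsky φ n) : ℂ)) =
      2 * (1 - chainParam (tau φ n * verblunsky φ n) : ℂ) := by
    have h := two_mul_chainParam hw
    linear_combination h
  replace h1 := congrArg (C (R := ℂ)) h1
  replace h2 := congrArg (C (R := ℂ)) h2
  rw [hφ.sub_mul_paraOrthogonal hμ, hφ.mul_succ hμ, hφ.mul_reversed_succ hμ]
  generalize tau φ n * verblunsky φ n = w at *
  generalize C (paraConst φ n) * φ n = p
  generalize C (paraConst φ n * tau φ n) * reversed φ n = q
  rw [C_add, C_mul (a := w)] at h1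
  rw [C_add, C_mul (a := conj w)] at h2
  linear_combination (X * p) * h1 - q * h2

lemma paraOrthogonal_zero (hμ : IsNontrivialCircleMeasure μ) (hφ : IsMonicOPUC μ φ) :
    paraOrthogonal φ 0 = 1 := by
  apply mul_left_cancel₀ (X_sub_C_ne_zero (1 : ℂ))
  rw [hφ.sub_mul_paraOrthogonal hμ]
  simp [hφ.apply_zero, hφ.tau_zero, paraConst, reversed]

lemma paraOrthogonal_one (hμ : IsNontrivialCircleMeasure μ) (hφ : IsMonicOPUC μ φ) :
    paraOrthogonal φ 1 =
      C (1 + Complex.I * (recurrenceCoeff (tau φ 0 * verblunsky φ 0) : ℂ)) * X +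
        C (1 - Complex.I * (recurrenceCoeff (tau φ 0 * verblunsky φ 0) : ℂ)) := by
  apply mul_left_cancel₀ (X_sub_C_ne_zero (1 : ℂ))
  have h := hφ.sub_mul_paraOrthogonal_succ hμ 0
  -- Since `φ_0 = φ_0^* = 1` and `τ_0 = 1`, the remainder vanishes at `n = 0`.
  have h1 : (C (paraConst φ 0) * φ 0 - C (paraConst φ 0 * tau φ 0) * reversed φ 0) = 0 := by
    simp [hφ.apply_zero, hφ.tau_zero, paraConst, reversed]
  rw [h1, hφ.paraOrthogonal_zero hμ, mul_zero, sub_zero, mul_one] at h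
  exact h.trans (mul_comm _ _)

lemma paraOrthogonal_succ_succ (hμ : IsNontrivialCircleMeasure μ) (hφ : IsMonicOPUC μ φ)
    (n : ℕ) :
    paraOrthogonal φ (n + 2) =
      (C (1 + Complex.I * (recurrenceCoeff (tau φ (n + 1) * verblunsky φ (n + 1)) : ℂ)) * X +
        C (1 - Complex.I * (recurrenceCoeff (tau φ (n + 1) * verblunsky φ (n + 1)) : ℂ))) *
          paraOrthogonal φ (n + 1) -
      C (4 * (((1 - chainParamSeq φ (n + 1)) * chainParamSeq φ (n + 2) : ℝ) : ℂ)) * X *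
        paraOrthogonal φ n := by
  apply mul_left_cancel₀ (X_sub_C_ne_zero (1 : ℂ))
  rw [hφ.sub_mul_paraOrthogonal_succ hμ, hφ.mul_sub_mul_reversed_succ hμ, chainParamSeq,
    chainParamSeq]
  have : (4 * (((1 - chainParam (tau φ n * verblunsky φ n)) *
      chainParam (tau φ (n + 1) * verblunsky φ (n + 1)) : ℝ) : ℂ)) =
      (2 * (chainParam (tau φ (n + 1) * verblunsky φ (n + 1)) : ℂ)) *
        (2 * (1 - chainParam (tau φ n * verblunsky φ n) : ℂ)) := by
    push_cast; ring
  rw [this, C_mul (a := 2 * (chainParam (tau φ (n + 1) * verblunsky φ (n + 1)) : ℂ))]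
  ring

/-- `R_n(0) = K_n τ_n`. Evaluating the recurrence at `0` then isolates `c_{n+1}`. -/
lemma eval_zero_paraOrthogonal_ne_zero (hμ : IsNontrivialCircleMeasure μ)
    (hφ : IsMonicOPUC μ φ) (n : ℕ) : (paraOrthogonal φ n).eval 0 ≠ 0 := by
  intro h0
  have h := congrArg (eval 0) (hφ.sub_mul_paraOrthogonal hμ n)
  have h1 : (reversed φ n).eval 0 = 1 := by
    rw [← coeff_zero_eq_eval_zero, coeff_reversed (Nat.zero_le n), Nat.sub_zero, hφ.coeff_self,
      map_one]
  have h2 : tau φ n ≠ 0 := norm_ne_zero_iff.1 (by rw [hφ.norm_tau hμ]; exact one_ne_zero)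
  simp [h0, h1, h2, hφ.paraConst_ne_zero hμ] at h

lemma isMinimalParameterSeq (hμ : IsNontrivialCircleMeasure μ) (hφ : IsMonicOPUC μ φ) :
    IsMinimalParameterSeq (fun n => (1 - chainParamSeq φ (n - 1)) * chainParamSeq φ n)
      (chainParamSeq φ) := by
  refine ⟨⟨⟨le_rfl, zero_lt_one⟩, fun n hn => ?_, fun n _ => rfl⟩, rfl⟩
  obtain ⟨k, rfl⟩ := Nat.exists_eq_add_of_le' hn
  have hw := hφ.norm_tau_mul_verblunsky_lt_one hμ k
  exact ⟨chainParam_pos hw, chainParam_lt_one hw⟩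

lemma isAssociatedPair (hμ : IsNontrivialCircleMeasure μ) (hφ : IsMonicOPUC μ φ) :
    IsAssociatedPair μ (fun n => recurrenceCoeff (tau φ (n - 1) * verblunsky φ (n - 1)))
      (fun n => (1 - chainParamSeq φ (n - 1)) * chainParamSeq φ n) := by
  refine ⟨⟨_, (hφ.isMinimalParameterSeq hμ).1⟩, φ, hφ, ?_, hφ.paraOrthogonal_zero hμ,
    hφ.paraOrthogonal_one hμ, fun n hn => ?_⟩
  · simp [chainParamSeq, chainParam, hφ.tau_zero]
  · obtain ⟨k, rfl⟩ := Nat.exists_eq_add_of_le' hn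
    exact hφ.paraOrthogonal_succ_succ hμ k

end IsMonicOPUC

/-! ### Uniqueness of the associated pair and of its minimal parameters. -/

namespace IsAssociatedPair

variable {μ : Measure ℂ} {φ : ℕ → ℂ[X]} {c d : ℕ → ℝ}

lemma eq_of_one_sub_I_mul {a b : ℝ}
    (h : 1 - Complex.I * (a : ℂ) = 1 - Complex.I * (b : ℂ)) : a = b := by
  simpa using h

lemma fst_eq (hμ : IsNontrivialCircleMeasure μ) (hφ : IsMonicOPUC μ φ)
    (h : IsAssociatedPair μ c d) (n : ℕ) :
    c (n + 1) = recurrenceCoeff (tau φ n * verblunsky φ n) := by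
  obtain ⟨-, ψ, hψ, -, -, h1, hs⟩ := h
  obtain rfl := hφ.eq hμ hψ
  apply eq_of_one_sub_I_mul
  cases n with
  | zero =>
    have := congrArg (eval 0) (h1.symm.trans (hφ.paraOrthogonal_one hμ))
    simpa only [eval_add, eval_mul, eval_X, eval_C, mul_zero, zero_add] using this
  | succ n =>
    have := congrArg (eval 0)
      ((hs (n + 1) (by omega)).symm.trans (hφ.paraOrthogonal_succ_succ hμ n))
    simp only [eval_add, eval_sub, eval_mul, eval_X, eval_C, mul_zero, zero_add, zero_mul,
      sub_zero] at this
    exact mul_right_cancel₀ (hφ.eval_zero_paraOrthogonal_ne_zero hμ _) this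

lemma snd_eq (hμ : IsNontrivialCircleMeasure μ) (hφ : IsMonicOPUC μ φ)
    (h : IsAssociatedPair μ c d) (n : ℕ) :
    d (n + 1) = (1 - chainParamSeq φ n) * chainParamSeq φ (n + 1) := by
  have hc := h.fst_eq hμ hφ n
  obtain ⟨-, ψ, hψ, hd, -, -, hs⟩ := h
  obtain rfl := hφ.eq hμ hψ
  cases n with
  | zero => simp [hd, chainParamSeq, chainParam, hφ.tau_zero]
  | succ n =>
    have := (hs (n + 1) (by omega)).symm.trans (hφ.paraOrthogonal_succ_succ hμ n)
    rw [hc, sub_right_inj, Nat.add_sub_cancel] at this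
    have hR : paraOrthogonal φ n ≠ 0 := fun h0 =>
      hφ.eval_zero_paraOrthogonal_ne_zero hμ n (by rw [h0, eval_zero])
    have := C_injective (mul_right_cancel₀ X_ne_zero (mul_right_cancel₀ hR this))
    exact_mod_cast mul_left_cancel₀ (by norm_num) this

lemma minimalParameterSeq_eq (hμ : IsNontrivialCircleMeasure μ) (hφ : IsMonicOPUC μ φ)
    (h : IsAssociatedPair μ c d) {m : ℕ → ℝ} (hm : IsMinimalParameterSeq d m) :
    m = chainParamSeq φ := by
  funext n
  induction n with
  | zero => exact hm.2
  | succ n ih =>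
    have h1 := hm.1.2.2 (n + 1) (by omega)
    rw [h.snd_eq hμ hφ, Nat.add_sub_cancel, ← ih] at h1
    have h2 : m n < 1 := by
      rcases n.eq_zero_or_pos with rfl | hn
      · exact hm.1.1.2
      · exact (hm.1.2.1 n hn).2
    exact (mul_left_cancel₀ (sub_pos.2 h2).ne' h1).symm

end IsAssociatedPair

/-! ### The reflection `w ↦ -((1 - conj w) / (1 - w)) w`. -/

section Reflection

variable {w v : ℂ}

/-- Up to a positive factor, the reflection conjugates `1 - w`. The ratio defining `c` ignores this
factor and changes sign, while `m` is multiplied by it, which yields `1 - m`. -/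
lemma one_sub_eq_ofReal_mul (hw : ‖w‖ < 1) (hv : v = -((1 - conj w) / (1 - w)) * w) :
    1 - v = (((1 - ‖w‖ ^ 2) / ‖1 - w‖ ^ 2 : ℝ) : ℂ) * (1 - conj w) := by
  have h1 := one_sub_ne_zero hw
  have h2 : 1 - conj w ≠ 0 := one_sub_ne_zero (by simpa using hw)
  have e1 := Complex.mul_conj' (1 - w)
  have e2 := Complex.mul_conj' w
  rw [map_sub, map_one] at e1
  push_cast
  rw [hv, ← e1, ← e2]
  field_simp
  ring

lemma recurrenceCoeff_reflection (hw : ‖w‖ < 1) (hv : v = -((1 - conj w) / (1 - w)) * w) :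
    recurrenceCoeff v = -recurrenceCoeff w := by
  have h := one_sub_eq_ofReal_mul hw hv
  have hk : (1 - ‖w‖ ^ 2) / ‖1 - w‖ ^ 2 ≠ 0 :=
    div_ne_zero (by nlinarith [norm_nonneg w])
      (pow_ne_zero 2 (norm_ne_zero_iff.2 (one_sub_ne_zero hw)))
  generalize (1 - ‖w‖ ^ 2) / ‖1 - w‖ ^ 2 = k at h hk
  have hre : 1 - v.re = k * (1 - w.re) := by simpa using congrArg Complex.re h
  have him : -v.im = k * w.im := by simpa using congrArg Complex.im h
  rw [recurrenceCoeff, recurrenceCoeff, hre, him, mul_div_mul_left _ _ hk, neg_div, neg_neg]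

lemma chainParam_reflection (hw : ‖w‖ < 1) (hv : v = -((1 - conj w) / (1 - w)) * w) :
    chainParam v = 1 - chainParam w := by
  have h := one_sub_eq_ofReal_mul hw hv
  have hn := norm_ne_zero_iff.2 (one_sub_ne_zero hw)
  have h1 : 1 - ‖w‖ ^ 2 ≠ 0 := by nlinarith [norm_nonneg w]
  have h2 := (one_sub_re_pos hw).ne'
  have hre : 1 - v.re = (1 - ‖w‖ ^ 2) / ‖1 - w‖ ^ 2 * (1 - w.re) := by
    have := congrArg Complex.re h
    rw [Complex.re_ofReal_mul] at this
    simpa using this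
  have hnorm : ‖1 - v‖ ^ 2 = ((1 - ‖w‖ ^ 2) / ‖1 - w‖ ^ 2) ^ 2 * ‖1 - w‖ ^ 2 := by
    have e : ‖1 - conj w‖ = ‖1 - w‖ := by
      rw [← RCLike.norm_conj (1 - w), map_sub, map_one]
    rw [h, norm_mul, mul_pow, e, Complex.norm_real, Real.norm_eq_abs, sq_abs]
  rw [one_sub_chainParam hw, chainParam, hre, hnorm]
  field_simp

end Reflection

lemma one_sub_I_mul_ne_zero (x : ℝ) : 1 - Complex.I * (x : ℂ) ≠ 0 := fun h => by
  simpa using congrArg Complex.re h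

lemma one_add_I_mul_ne_zero (x : ℝ) : 1 + Complex.I * (x : ℂ) ≠ 0 := fun h => by
  simpa using congrArg Complex.re h

end OPUC
end

/-! ### Comparison of the two measures. -/

open OPUC in
theorem mainTheorem7
    (μ : MeasureTheory.Measure ℂ) (hμ : OPUC.IsNontrivialCircleMeasure μ)
    (c d m : ℕ → ℝ) (hcd : OPUC.IsAssociatedPair μ c d)
    (hm : OPUC.IsMinimalParameterSeq d m)
    (hc : ∀ n : ℕ, 1 ≤ n → c (2 * n) = -c (2 * n - 1))
    (α : ℕ → ℂ) (hα : OPUC.HasVerblunskyCoeffs μ α)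
    (β : ℕ → ℂ)
    (hβ : ∀ n : ℕ, 1 ≤ n → β n =
      -((1 + Complex.I * (c (2 * n) : ℂ)) / (1 - Complex.I * (c (2 * n) : ℂ))))
    (α' : ℕ → ℂ)
    (hα'_odd : ∀ n : ℕ, α' (2 * n + 1) =
      (∏ j ∈ Finset.Icc 1 (n + 1), β j ^ 2) * α (2 * n + 1))
    (hα'_even : ∀ n : ℕ, α' (2 * n) =
      (∏ j ∈ Finset.Icc 1 n, β j ^ 2) * β (n + 1) * α (2 * n))
    (μ' : MeasureTheory.Measure ℂ) (hμ' : OPUC.IsNontrivialCircleMeasure μ')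
    (hμ'α' : OPUC.HasVerblunskyCoeffs μ' α') :
    (∃ c' d' m' : ℕ → ℝ,
      OPUC.IsAssociatedPair μ' c' d' ∧ OPUC.IsMinimalParameterSeq d' m') ∧
    ∀ c' d' m' : ℕ → ℝ,
      OPUC.IsAssociatedPair μ' c' d' → OPUC.IsMinimalParameterSeq d' m' →
      ∀ n : ℕ, 1 ≤ n →
        c' (2 * n) = c (2 * n) ∧ c' (2 * n - 1) = c (2 * n) ∧
        m' (2 * n - 1) = 1 - m (2 * n - 1) ∧ m' (2 * n) = m (2 * n) := by
  obtain ⟨φ, hφ, hα⟩ := hα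
  obtain ⟨ψ, hψ, hα'⟩ := hμ'α'
  refine ⟨⟨_, _, _, hψ.isAssociatedPair hμ', hψ.isMinimalParameterSeq hμ'⟩, ?_⟩
  have hcφ := hcd.fst_eq hμ hφ
  have hcc : ∀ n, c (2 * n + 2) = -c (2 * n + 1) := fun n => hc (n + 1) (by omega)
  -- The sign hypothesis rewrites `β_{n+1}` through `c_{2n+1}`; clearing the denominator makes the
  -- later phase computations linear combinations.
  have hβ' : ∀ n, (1 + Complex.I * (c (2 * n + 1) : ℂ)) * β (n + 1) =
      -(1 - Complex.I * (c (2 * n + 1) : ℂ)) := fun n => by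
    have h1 := one_add_I_mul_ne_zero (c (2 * n + 1))
    rw [hβ (n + 1) (by omega), show 2 * (n + 1) = 2 * n + 2 by ring, hcc]
    push_cast
    simp only [mul_neg, sub_neg_eq_add, neg_inj, ← sub_eq_add_neg]
    exact mul_div_cancel₀ _ h1
  have hodd : ∀ n, tau φ (2 * n) = 1 → tau φ (2 * n + 1) = -β (n + 1) := fun n hn => by
    have h1 := hφ.tau_succ' hμ (2 * n)
    rw [← hcφ, hn] at h1
    apply mul_left_cancel₀ (one_add_I_mul_ne_zero (c (2 * n + 1)))
    linear_combination h1 + hβ' n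
  have heven : ∀ n, tau φ (2 * n) = 1 := fun n => by
    induction n with
    | zero => exact hφ.tau_zero
    | succ n ih =>
      have h2 := hφ.tau_succ' hμ (2 * n + 1)
      rw [← hcφ, hodd n ih, hcc] at h2
      push_cast at h2
      apply mul_left_cancel₀ (one_sub_I_mul_ne_zero (c (2 * n + 1)))
      rw [show 2 * (n + 1) = 2 * n + 1 + 1 by ring]
      linear_combination h2 - hβ' n
  obtain ⟨P, hP⟩ : ∃ P : ℕ → ℂ, ∀ n, ∏ j ∈ Finset.Icc 1 n, β j ^ 2 = P n := ⟨_, fun _ => rfl⟩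
  have hPs : ∀ n, P (n + 1) = P n * β (n + 1) ^ 2 := fun n => by
    rw [← hP, ← hP, Finset.prod_Icc_succ_top (by omega)]
  -- The phase identity is a hypothesis here because `hψeven` proves it by an induction that itself
  -- uses this step.
  have hw0 : ∀ n, tau ψ (2 * n) * P n = 1 → tau ψ (2 * n) * verblunsky ψ (2 * n) =
      -((1 - starRingEnd ℂ (tau φ (2 * n) * verblunsky φ (2 * n))) /
        (1 - tau φ (2 * n) * verblunsky φ (2 * n))) *
        (tau φ (2 * n) * verblunsky φ (2 * n)) := fun n hn => by
    have hw := hφ.norm_tau_mul_verblunsky_lt_one hμ (2 * n)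
    have h1 := one_add_I_mul_ne_zero (c (2 * n + 1))
    have h2 : -((1 - starRingEnd ℂ (tau φ (2 * n) * verblunsky φ (2 * n))) /
        (1 - tau φ (2 * n) * verblunsky φ (2 * n))) = β (n + 1) := by
      apply mul_left_cancel₀ h1
      rw [hβ', hcφ, one_add_I_mul_recurrenceCoeff hw, one_sub_I_mul_recurrenceCoeff hw]
      have := one_sub_ne_zero hw
      field_simp
    rw [h2, ← hα', ← hα, hα'_even, hP, heven]
    linear_combination β (n + 1) * α (2 * n) * hn
  have hψodd : ∀ n, tau ψ (2 * n) * P n = 1 → tau ψ (2 * n + 1) * P n * β (n + 1) = -1 :=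
    fun n hn => by
      have h1 := hψ.tau_succ' hμ' (2 * n)
      rw [recurrenceCoeff_reflection (hφ.norm_tau_mul_verblunsky_lt_one hμ _) (hw0 n hn),
        ← hcφ] at h1
      push_cast at h1
      apply mul_left_cancel₀ (one_sub_I_mul_ne_zero (c (2 * n + 1)))
      linear_combination (P n * β (n + 1)) * h1 +
        (1 + Complex.I * (c (2 * n + 1) : ℂ)) * β (n + 1) * hn + hβ' n
  have hw1 : ∀ n, tau ψ (2 * n) * P n = 1 →
      tau ψ (2 * n + 1) * verblunsky ψ (2 * n + 1) =
        tau φ (2 * n + 1) * verblunsky φ (2 * n + 1) := fun n hn => by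
    have h1 := hψodd n hn
    rw [← hα', ← hα, hα'_odd, hodd n (heven n), hP, hPs]
    linear_combination (β (n + 1) * α (2 * n + 1)) * h1
  have hψeven : ∀ n, tau ψ (2 * n) * P n = 1 := fun n => by
    induction n with
    | zero => simp [hψ.tau_zero, ← hP]
    | succ n ih =>
      have h1 := hψ.tau_succ' hμ' (2 * n + 1)
      rw [hw1 n ih, ← hcφ, hcc] at h1
      push_cast at h1
      rw [show 2 * (n + 1) = 2 * n + 1 + 1 by ring, hPs]
      apply mul_left_cancel₀ (one_sub_I_mul_ne_zero (c (2 * n + 1)))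
      have h3 := hψodd n ih
      linear_combination P n * β (n + 1) ^ 2 * h1 +
        (1 + Complex.I * (c (2 * n + 1) : ℂ)) * β (n + 1) * h3 - hβ' n
  intro c' d' m' h' hm' n hn
  obtain ⟨k, rfl⟩ := Nat.exists_eq_add_of_le' hn
  have hc' := h'.fst_eq hμ' hψ
  obtain rfl := h'.minimalParameterSeq_eq hμ' hψ hm'
  obtain rfl := hcd.minimalParameterSeq_eq hμ hφ hm
  have hw := hφ.norm_tau_mul_verblunsky_lt_one hμ (2 * k)
  have e0 := hw0 k (hψeven k)
  have e1 := hw1 k (hψeven k)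
  -- Indices shift by one: entries `2k + 1` and `2k + 2` come from `w_{2k}` (reflected) and
  -- `w_{2k+1}` (unchanged).
  refine ⟨?_, ?_, ?_, ?_⟩
  · change c' (2 * k + 1 + 1) = c (2 * k + 1 + 1)
    rw [hc', hcφ, e1]
  · change c' (2 * k + 1) = c (2 * k + 2)
    rw [hc', hcc, hcφ, recurrenceCoeff_reflection hw e0]
  · exact chainParam_reflection hw e0
  · exact congrArg chainParam e1
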